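/- Let $\mathrm{SU}(2)$ carry the bi-invariant Riemannian metric determined by the $\mathrm{Ad}$-invariant inner product $\langle X,Y\rangle=\tfrac12\,\mathrm{tr}(XY^*)$ on $\mathfrak{su}(2)$, let $U(1)\subset \mathrm{SU}(2)$ be the subgroup of diagonal matrices $s=\mathrm{diag}(z,\bar z)$, $|z|=1$, and let $S^2=\mathrm{SU}(2)/U(1)$ carry the induced Riemannian metric, with Riemannian distance $\rho$. For $n\in\mathbb Z$ let $$\Xi_n=\{\xi\in C(\mathrm{SU}(2)):\ \xi(xs)=\overline{z^{n}}\,\xi(x)\ \text{ for all } x\in \mathrm{SU}(2),\ s=\mathrm{diag}(z,\bar z)\in U(1)\},$$ a module over $C(S^2)$ under pointwise multiplication (the continuous sections of the monopole bundle of charge $|n|$ if $n\neq0$). Let $v_0=(1,0)\in\mathbb C^2$ if $n\ge 0$ and $v_0=(0,1)$ if $n<0$. Let $\mathcal K_n\subset(\mathbb C^2)^{\otimes|n|}$ be the linear span of the orbit of $v_0^{\otimes |n|}$ under the $|n|$-th tensor power of the standard representation of $\mathrm{SU}(2)$ on $\mathbb C^2$, with the inherited inner product. Let $U^{(n)}$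 be the representation of $\mathrm{SU}(2)$ on $\mathcal K_n$ by restriction, let $P_n$ be the orthogonal projection of $\mathcal K_n$ onto $\mathbb C v_0^{\otimes|n|}$, and let $p_n\in C(S^2,\mathcal B(\mathcal K_n))$ be given by $p_n(xU(1))=U^{(n)}_xP_nU^{(n)*}_x$. Then, for every $n\in\mathbb Z$, $p_n$ is a projection for $\Xi_n$, that is, each $p_n(a)$ is an orthogonal projection and $\Xi_n\cong p_n\,C(S^2,\mathcal K_n)$ as $C(S^2)$-modules, and $$L(p_n)=\sup_{a\ne b}\frac{\|p_n(a)-p_n(b)\|}{\rho(a,b)}=|n|^{1/2},$$ where the norm is the operator norm on $\mathcal B(\mathcal K_n)$. -/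

import Mathlib

open scoped InnerProductSpace ENNReal ComplexConjugate

noncomputable section

namespace Monopole

/-- The group `SU(2)`. -/
abbrev SU2 : Type := Matrix.specialUnitaryGroup (Fin 2) ℂ

/-- The diagonal subgroup `U(1)` of `SU(2)`, i.e. the matrices `diag(z, conj z)` with `|z| = 1`. -/
def U1 : Subgroup SU2 where
  carrier := {x | x.1 0 1 = 0 ∧ x.1 1 0 = 0}
  mul_mem' := by
    rintro a b ⟨ha, ha'⟩ ⟨hb, hb'⟩
    simp [Matrix.mul_apply, Fin.sum_univ_two, ha, ha', hb, hb']
  one_mem' := by simp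
  inv_mem' := by
    rintro a ⟨ha, ha'⟩
    have h : (a⁻¹).1 = star a.1 := rfl
    simp [h, Matrix.star_apply, ha, ha']

/-- The two-sphere, as the homogeneous space `SU(2)/U(1)`. -/
abbrev Sphere : Type := SU2 ⧸ U1

/-- The quotient map `SU(2) → SU(2)/U(1)`. -/
def proj : C(SU2, Sphere) := ⟨fun x => (x : Sphere), continuous_quot_mk⟩

/-! ### The Riemannian metric of the sphere -/

/-- The norm on `su(2)` of the Ad-invariant inner product `⟨X, Y⟩ = 2⁻¹ tr (X Y^*)`. -/
def lieNorm (X : Matrix (Fin 2) (Fin 2) ℂ) : ℝ :=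
  Real.sqrt (2⁻¹ * (Matrix.trace (X * star X)).re)

/-- The orthogonal projection of `su(2)` onto the orthogonal complement `𝔪` of the Lie algebra of
`U(1)`: the latter consists of the diagonal matrices in `su(2)`, so that `𝔪` consists of those
with vanishing diagonal. The tangent space of `SU(2)/U(1)` at the class of `x` is identified with
`𝔪`, through `W ↦ d/dt|₀ (x exp (t W))`. -/
def horizontal (X : Matrix (Fin 2) (Fin 2) ℂ) : Matrix (Fin 2) (Fin 2) ℂ :=
  Matrix.of fun i j => if i = j then 0 else X i j

/-- The (entrywise) derivative of a curve in `SU(2)` that is parametrized by `[0, 1]`. -/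
def velocity (γ : ℝ → SU2) (t : ℝ) : Matrix (Fin 2) (Fin 2) ℂ :=
  Matrix.of fun i j => derivWithin (fun s => (γ s).1 i j) (Set.Icc 0 1) t

/-- `γ` is a `C¹` curve in `SU(2)` that is parametrized by `[0, 1]`. -/
def IsC1Curve (γ : ℝ → SU2) : Prop :=
  ∀ i j, ContDiffOn ℝ 1 (fun s => (γ s).1 i j) (Set.Icc 0 1)

/-- The length of the curve `t ↦ γ(t) U(1)` in `SU(2)/U(1)`, for the Riemannian metric that is
induced from the bi-invariant one of `SU(2)`: the velocity of this curve at time `t` is the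
`𝔪`-component of `γ(t)⁻¹ γ'(t) ∈ su(2)`, and its norm does not depend on the lift `γ`. -/
def quotientLength (γ : ℝ → SU2) : ℝ≥0∞ :=
  ∫⁻ t in Set.Icc (0 : ℝ) 1,
    ENNReal.ofReal (lieNorm (horizontal (star (γ t).1 * velocity γ t)))

/-- The Riemannian distance of `SU(2)/U(1)`: the infimum of the lengths of the `C¹` curves between
the two points. The `C¹` curves in `SU(2)/U(1)` are the images of the `C¹` curves in `SU(2)`. -/
def sphereDist (a b : Sphere) : ℝ≥0∞ :=
  ⨅ (γ : ℝ → SU2) (_ : IsC1Curve γ ∧ proj (γ 0) = a ∧ proj (γ 1) = b), quotientLength γ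

/-- The Lipschitz constant (possibly `∞`) of a function on the sphere with values in a normed
space. -/
def lipConst {V : Type*} [NormedAddCommGroup V] (F : Sphere → V) : ℝ≥0∞ :=
  ⨆ (a : Sphere) (b : Sphere) (_ : a ≠ b), ‖F a - F b‖ₑ / sphereDist a b

/-! ### The modules of the monopole bundles -/

/-- `Ξ_n = {ξ ∈ C(SU(2)) : ξ(x s) = conj (z ^ n) ξ(x) for s = diag(z, conj z) ∈ U(1)}`, the
continuous sections of the monopole bundle. With `z = e(t)`, the factor is `conj (e(n t))`. -/
def Xi (n : ℤ) : AddSubgroup C(SU2, ℂ) where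
  carrier := {ξ | ∀ x s : SU2, s ∈ U1 → ξ (x * s) = conj (s.1 0 0 ^ n) * ξ x}
  add_mem' := by
    intro a b ha hb x s hs
    simp only [ContinuousMap.add_apply, ha x s hs, hb x s hs, mul_add]
  zero_mem' := by intro x s _; simp
  neg_mem' := by
    intro a ha x s hs
    simp only [ContinuousMap.neg_apply, ha x s hs, mul_neg]

lemma proj_mul (x s : SU2) (hs : s ∈ U1) : proj (x * s) = proj x :=
  (QuotientGroup.eq.2 (by simpa using hs)).symm

/-- `Ξ_n` is a module over `C(SU(2)/U(1))`, by pointwise multiplication. -/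
instance (n : ℤ) : Module C(Sphere, ℂ) (Xi n) where
  smul f ξ := ⟨f.comp proj * ξ.1, by
    intro x s hs
    simp only [ContinuousMap.mul_apply, ContinuousMap.comp_apply, proj_mul x s hs, ξ.2 x s hs]
    ring⟩
  one_smul ξ := Subtype.ext (by
    change (1 : C(Sphere, ℂ)).comp proj * ξ.1 = ξ.1
    ext x; simp)
  mul_smul f g ξ := Subtype.ext (by
    change (f * g).comp proj * ξ.1 = f.comp proj * (g.comp proj * ξ.1)
    ext x; simp [mul_assoc])
  smul_zero f := Subtype.ext (by
    change f.comp proj * (0 : C(SU2, ℂ)) = 0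
    simp)
  smul_add f ξ η := Subtype.ext (by
    change f.comp proj * (ξ.1 + η.1) = f.comp proj * ξ.1 + f.comp proj * η.1
    exact mul_add _ _ _)
  add_smul f g ξ := Subtype.ext (by
    change (f + g).comp proj * ξ.1 = f.comp proj * ξ.1 + g.comp proj * ξ.1
    ext x; simp [add_mul])
  zero_smul ξ := Subtype.ext (by
    change (0 : C(Sphere, ℂ)).comp proj * ξ.1 = 0
    ext x; simp)

/-! ### The representations and the projections -/

/-- The Hilbert space `(ℂ²)^{⊗N}`, in the coordinates of its orthonormal basis
`e_{i 0} ⊗ ⋯ ⊗ e_{i (N-1)}`, `i : Fin N → Fin 2`. -/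
abbrev TensorPow (N : ℕ) : Type := EuclideanSpace ℂ (Fin N → Fin 2)

/-- The vector `v ⊗ ⋯ ⊗ v` of `(ℂ²)^{⊗N}`. -/
def vecPow (N : ℕ) (v : Fin 2 → ℂ) : TensorPow N :=
  WithLp.toLp 2 fun i => ∏ k, v (i k)

/-- The `N`-th tensor power of the standard representation of `SU(2)` on `ℂ²`. -/
def tensorRep (N : ℕ) : SU2 →* (TensorPow N →L[ℂ] TensorPow N) where
  toFun x := Matrix.toEuclideanCLM (𝕜 := ℂ) (Matrix.of fun i j => ∏ k, x.1 (i k) (j k))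
  map_one' := by
    rw [← map_one (Matrix.toEuclideanCLM (n := Fin N → Fin 2) (𝕜 := ℂ))]
    congr 1
    ext i j
    simp only [Matrix.of_apply, Matrix.one_apply, OneMemClass.coe_one]
    by_cases h : i = j
    · simp [h]
    · obtain ⟨k, hk⟩ := Function.ne_iff.1 h
      rw [if_neg h]
      exact Finset.prod_eq_zero (Finset.mem_univ k) (by simp [hk])
  map_mul' x y := by
    rw [← map_mul (Matrix.toEuclideanCLM (n := Fin N → Fin 2) (𝕜 := ℂ))]
    congr 1
    ext i j
    simp only [Matrix.of_apply, Matrix.mul_apply, Submonoid.coe_mul, ← Finset.prod_mul_distrib]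
    rw [Finset.prod_univ_sum]
    simp

/-- The weight vector of `ℂ²` from which the projection for `Ξ_n` is built: `diag(z, conj z)` acts
on it as `z` if `n ≥ 0`, and as `conj z` if `n < 0`. -/
def weightVec (n : ℤ) : Fin 2 → ℂ := if 0 ≤ n then ![1, 0] else ![0, 1]

/-- The `SU(2)`-invariant subspace `K_n` of `(ℂ²)^{⊗|n|}` that is generated by the `|n|`-th tensor
power of the weight vector. -/
def orbitSpan (n : ℤ) : Submodule ℂ (TensorPow n.natAbs) :=
  Submodule.span ℂ
    (Set.range fun x : SU2 => tensorRep n.natAbs x (vecPow n.natAbs (weightVec n)))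

lemma orbitSpan_invariant (n : ℤ) (x : SU2) {w : TensorPow n.natAbs} (hw : w ∈ orbitSpan n) :
    tensorRep n.natAbs x w ∈ orbitSpan n := by
  have h : orbitSpan n ≤ (orbitSpan n).comap (tensorRep n.natAbs x).toLinearMap := by
    refine Submodule.span_le.2 ?_
    rintro _ ⟨y, rfl⟩
    refine Submodule.subset_span ⟨x * y, ?_⟩
    simp [map_mul]
  exact h hw

lemma vecPow_mem (n : ℤ) : vecPow n.natAbs (weightVec n) ∈ orbitSpan n :=
  Submodule.subset_span ⟨1, by simp⟩

/-- The Hilbert space `K_n`, with the inner product of `(ℂ²)^{⊗|n|}`. -/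
def K (n : ℤ) : Type := orbitSpan n

instance (n : ℤ) : NormedAddCommGroup (K n) := inferInstanceAs (NormedAddCommGroup (orbitSpan n))

instance (n : ℤ) : InnerProductSpace ℂ (K n) := inferInstanceAs (InnerProductSpace ℂ (orbitSpan n))

instance (n : ℤ) : FiniteDimensional ℂ (K n) := inferInstanceAs (FiniteDimensional ℂ (orbitSpan n))

instance (n : ℤ) : CompleteSpace (K n) := FiniteDimensional.complete ℂ (K n)

/-- The representation `U^{(n)}` of `SU(2)` on `K_n`, the restriction of the tensor power. -/
def U (n : ℤ) : SU2 →* (K n →L[ℂ] K n) where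
  toFun x := ((tensorRep n.natAbs x).comp (orbitSpan n).subtypeL).codRestrict (orbitSpan n)
    fun w => orbitSpan_invariant n x w.2
  map_one' := by
    refine ContinuousLinearMap.ext fun w => Subtype.ext ?_
    change tensorRep n.natAbs 1 w.1 = w.1
    rw [map_one]; rfl
  map_mul' x y := by
    refine ContinuousLinearMap.ext fun w => Subtype.ext ?_
    change tensorRep n.natAbs (x * y) w.1 = tensorRep n.natAbs x (tensorRep n.natAbs y w.1)
    rw [map_mul]; rfl

/-- The unit vector of `K_n` that spans the line on which `U(1)` acts by the `n`-th character. -/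
def v (n : ℤ) : K n := ⟨vecPow n.natAbs (weightVec n), vecPow_mem n⟩

/-- The orthogonal projection `P_n` of `K_n` onto the line spanned by `v n`. -/
def P (n : ℤ) : K n →L[ℂ] K n := (ℂ ∙ v n).starProjection

/-- The function `x ↦ U_x P_n U_x^*` on `SU(2)`. -/
def projFun (n : ℤ) (x : SU2) : K n →L[ℂ] K n :=
  U n x * P n * ContinuousLinearMap.adjoint (U n x)

lemma norm_v (n : ℤ) : ‖v n‖ = 1 := by
  have h : vecPow n.natAbs (weightVec n)
      = EuclideanSpace.single (fun _ => if 0 ≤ n then 0 else 1) 1 := by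
    ext i
    simp only [vecPow, weightVec, PiLp.single_apply]
    by_cases hi : i = fun _ => if 0 ≤ n then 0 else 1
    · rw [if_pos hi]
      refine Finset.prod_eq_one fun k _ => ?_
      rw [hi]
      by_cases hn : 0 ≤ n <;> simp [hn]
    · rw [if_neg hi]
      obtain ⟨k, hk⟩ := Function.ne_iff.1 hi
      refine Finset.prod_eq_zero (Finset.mem_univ k) ?_
      by_cases hn : 0 ≤ n
      · have h1 : i k = 1 := by simp only [hn, if_true] at hk; omega
        simp [hn, h1]
      · have h0 : i k = 0 := by simp only [hn, if_false] at hk; omega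
        simp [hn, h0]
  change ‖vecPow n.natAbs (weightVec n)‖ = 1
  rw [h]
  simp

lemma projFun_eq (n : ℤ) (x : SU2) :
    projFun n x = InnerProductSpace.rankOne ℂ (U n x (v n)) (U n x (v n)) := by
  have h : ∀ w : K n, P n w = ⟪v n, w⟫_ℂ • v n := fun w =>
    Submodule.starProjection_unit_singleton ℂ (norm_v n) w
  refine ContinuousLinearMap.ext fun w => ?_
  change U n x (P n (ContinuousLinearMap.adjoint (U n x) w)) = _
  rw [h, map_smul, ContinuousLinearMap.adjoint_inner_right]
  rfl

lemma U_apply_v_apply (n : ℤ) (x : SU2) (i : Fin n.natAbs → Fin 2) :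
    (U n x (v n)).1 i = ∏ k, (x.1.mulVec (weightVec n)) (i k) := by
  change (Matrix.mulVec (Matrix.of fun i j : Fin n.natAbs → Fin 2 => ∏ k, x.1 (i k) (j k))
    (fun i : Fin n.natAbs → Fin 2 => ∏ k, weightVec n (i k))) i = _
  simp only [Matrix.mulVec, dotProduct, Matrix.of_apply, ← Finset.prod_mul_distrib]
  rw [Finset.prod_univ_sum]
  simp

lemma continuous_projFun (n : ℤ) : Continuous (projFun n) := by
  have hU : Continuous fun x : SU2 => U n x (v n) := by
    refine Continuous.subtype_mk (f := fun x : SU2 => (U n x (v n)).1) ?_ _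
    refine (PiLp.continuous_toLp 2 _).comp
      (f := fun x : SU2 => fun i => (U n x (v n)).1 i) (continuous_pi fun i => ?_)
    simp only [U_apply_v_apply]
    exact continuous_finsetProd _ fun k _ => (continuous_apply (i k)).comp
      (Continuous.matrix_mulVec continuous_subtype_val continuous_const)
  have : projFun n = fun x => InnerProductSpace.rankOne ℂ (U n x (v n)) (U n x (v n)) :=
    funext (projFun_eq n)
  rw [this]
  refine continuous_clm_apply.2 fun w => ?_
  exact (hU.inner (𝕜 := ℂ) (continuous_const (y := w))).smul hU

lemma projFun_mul (n : ℤ) (x s : SU2) (hs : s ∈ U1) : projFun n (x * s) = projFun n x := by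
  obtain ⟨h01, h10⟩ := hs
  have hdiag : ∀ i, ‖s.1 i i‖ = 1 := by
    intro i
    have h := congrFun (congrFun
      (Matrix.mem_unitaryGroup_iff.1 (Matrix.specialUnitaryGroup_le_unitaryGroup s.2)) i) i
    have h2 : s.1 i i * conj (s.1 i i) = 1 := by
      fin_cases i <;>
        simpa [Matrix.mul_apply, Fin.sum_univ_two, Matrix.star_apply, h01, h10] using h
    rw [Complex.mul_conj, Complex.normSq_eq_norm_sq] at h2
    have h3 : ‖s.1 i i‖ ^ 2 = 1 := by exact_mod_cast h2
    exact (pow_eq_one_iff_of_nonneg (norm_nonneg _) two_ne_zero).1 h3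
  obtain ⟨c, hc, hv⟩ : ∃ c : ℂ, ‖c‖ = 1 ∧ U n s (v n) = c • v n := by
    obtain ⟨z, hz, hw⟩ : ∃ z : ℂ, ‖z‖ = 1 ∧ s.1.mulVec (weightVec n) = z • weightVec n := by
      by_cases hn : 0 ≤ n
      · refine ⟨s.1 0 0, hdiag 0, ?_⟩
        ext i
        fin_cases i <;> simp [weightVec, hn, Matrix.mulVec, dotProduct, h10]
      · refine ⟨s.1 1 1, hdiag 1, ?_⟩
        ext i
        fin_cases i <;> simp [weightVec, hn, Matrix.mulVec, dotProduct, h01]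
    refine ⟨z ^ n.natAbs, by simp [hz], Subtype.ext ?_⟩
    ext i
    rw [U_apply_v_apply, hw]
    change _ = z ^ n.natAbs * ∏ k, weightVec n (i k)
    simp [Finset.prod_mul_distrib]
  have hcc : c * conj c = 1 := by
    rw [Complex.mul_conj, Complex.normSq_eq_norm_sq, hc]; simp
  have hU : U n (x * s) (v n) = c • U n x (v n) := by
    rw [map_mul, mul_apply_eq_comp, hv, map_smul]
  rw [projFun_eq, projFun_eq, hU]
  simp [smul_smul, hcc]

/-- The projection `p_n ∈ C(SU(2)/U(1), B(K_n))`, `p_n(x U(1)) = U_x P_n U_x^*`. -/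
def monopoleProj (n : ℤ) : C(Sphere, K n →L[ℂ] K n) where
  toFun := Quotient.lift (projFun n) fun x y h => by
    have h' : x⁻¹ * y ∈ U1 := QuotientGroup.leftRel_apply.1 h
    have := projFun_mul n x _ h'
    rw [mul_inv_cancel_left] at this
    exact this.symm
  continuous_toFun := (continuous_projFun n).quotient_lift _

/-- The `C(SU(2)/U(1))`-module `p C(SU(2)/U(1), V)` of a function `p` on the sphere with values in
the operators on `V`, as the fixed points of `p`; it is the range of `p` if `p` is idempotent. -/
def projRange {V : Type*} [NormedAddCommGroup V] [NormedSpace ℂ V] (p : C(Sphere, V →L[ℂ] V)) :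
    Submodule C(Sphere, ℂ) C(Sphere, V) where
  carrier := {F | ∀ a, p a (F a) = F a}
  add_mem' := by
    intro F G hF hG a
    simp [hF a, hG a]
  zero_mem' := by intro a; simp
  smul_mem' := by
    intro f F hF a
    simp [hF a]

end Monopole

end

/-! The operator `p_n(xU(1))` is the rank one projection onto the line of the unit vector `U_x v`,
so everything is read off from inner products of the vectors `U_x v`.

Module: `U(1)` acts on `v` by `z ^ n`, which cancels the factor `conj (z ^ n)` of `ξ ∈ Ξ_n`. Hence
`ξ ↦ ξ(x) U_x v` descends to the sphere, with inverse `F ↦ ⟪U_x v, F⟫`.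

Lipschitz constant: two such projections differ in norm by `√(1 - |⟪U_x v, U_y v⟫|²)`. The inner
product has modulus `|overlap x y| ^ |n|`, and `|overlap|² = 1 - δ²` with `δ = ‖columnDet x y‖`.
Thus `‖p_n(a) - p_n(b)‖² = 1 - (1 - δ²) ^ |n|`, which is at most `|n| δ²` by Bernoulli. Now `δ` is
the chord between the Hopf images, on a sphere of radius 1/2, and the Hopf map preserves lengths, so
`δ ≤ ρ` (`enorm_columnDet_le_quotientLength`). For sharpness, rotations by `θ → 0` give points with
`ρ ≤ θ` and `δ = |sin θ|`, whose quotients have lower bounds tending to `√|n|` (`le_lipConst`). -/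

namespace InnerProductSpace

/-! ### Distance between rank one projections -/

variable {E : Type*} [NormedAddCommGroup E] [InnerProductSpace ℂ E] [CompleteSpace E]

/-- The distance between two rank one projections. -/
theorem norm_sq_rankOne_sub_rankOne {x y : E} (hx : ‖x‖ = 1) (hy : ‖y‖ = 1) :
    ‖rankOne ℂ x x - rankOne ℂ y y‖ ^ 2 = 1 - ‖⟪x, y⟫_ℂ‖ ^ 2 := by
  set T : E →L[ℂ] E := rankOne ℂ x x - rankOne ℂ y y with hT
  set d : ℝ := 1 - ‖⟪x, y⟫_ℂ‖ ^ 2 with hd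
  have hxx : ⟪x, x⟫_ℂ = 1 := by simp [inner_self_eq_norm_sq_to_K, hx]
  have hyy : ⟪y, y⟫_ℂ = 1 := by simp [inner_self_eq_norm_sq_to_K, hy]
  have hxy : ⟪x, y⟫_ℂ * ⟪y, x⟫_ℂ = ((1 - d : ℝ) : ℂ) := by
    rw [← inner_conj_symm y x, Complex.mul_conj, Complex.normSq_eq_norm_sq]
    congr 1
    rw [hd]; ring
  have hTw (w : E) : T w = ⟪x, w⟫_ℂ • x - ⟪y, w⟫_ℂ • y := by simp [hT]
  have hTx : T (T x) = (d : ℂ) • x := by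
    simp only [hTw, hxx, inner_sub_right, inner_smul_right, one_smul]
    rw [hyy, mul_comm ⟪y, x⟫_ℂ ⟪x, y⟫_ℂ, hxy]
    simp
  have hTy : T (T y) = (d : ℂ) • y := by
    simp only [hTw, hyy, inner_sub_right, inner_smul_right]
    rw [hxx, hxy, mul_one, one_mul, sub_self, zero_smul, zero_sub, ← neg_smul]
    congr 1
    simp
  have hsa : IsSelfAdjoint T :=
    (isStarProjection_rankOne_self hx).isSelfAdjoint.sub
      (isStarProjection_rankOne_self hy).isSelfAdjoint
  -- The range of `T` lies in the span of `x` and `y`, where `T²` acts as the scalar `d`; hence `T⁴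
  -- = d T²`. Since `T` is self-adjoint, its norm is multiplicative on these powers, so `‖T‖²` is
  -- `d` or `0`.
  have hT4 : T ^ (2 ^ 2) = (d : ℂ) • T ^ (2 ^ 1) := by
    ext w
    change T (T (T (T w))) = (d : ℂ) • T (T w)
    conv_lhs => rw [hTw w]
    conv_rhs => rw [hTw w]
    simp only [map_sub, map_smul, hTx, hTy, smul_sub]
    simp only [smul_comm (d : ℂ)]
  have hd0 : 0 ≤ d := by
    have := norm_inner_le_norm (𝕜 := ℂ) x y
    rw [hx, hy, one_mul] at this
    have := pow_le_one₀ (n := 2) (norm_nonneg _) this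
    linarith
  have hnorm : (‖T‖ ^ 2) ^ 2 = d * ‖T‖ ^ 2 := by
    have h2 := hsa.norm_pow_two_pow 2
    rw [hT4, norm_smul, hsa.norm_pow_two_pow 1, Complex.norm_real, Real.norm_of_nonneg hd0] at h2
    norm_num at h2
    rw [h2]; ring
  -- If `T = 0`, then `T² x = d x` with `x ≠ 0` forces `d = 0` as well.
  rcases eq_or_ne (‖T‖ ^ 2) 0 with h0 | h0
  · have hT0 : T = 0 := by simpa using h0
    have : (d : ℂ) • x = 0 := by rw [← hTx, hT0]; simp
    have hx0 : x ≠ 0 := by rintro rfl; simp at hx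
    have : d = 0 := by simpa [hx0] using this
    rw [h0, this]
  · rw [sq] at hnorm
    exact mul_right_cancel₀ h0 hnorm

end InnerProductSpace

namespace Monopole

/-! ### Columns of SU(2) matrices and the norm of `p_n(a) - p_n(b)` -/

/-- Both sides are the inverse of `x`. Comparing entries expresses the second column through the
first. -/
lemma star_eq_adjugate (x : SU2) : star x.1 = x.1.adjugate := by
  have h := Matrix.mem_specialUnitaryGroup_iff.1 x.2
  have h1 : star x.1 * x.1 = 1 := Matrix.mem_unitaryGroup_iff'.1 h.1
  calc star x.1 = star x.1 * (x.1 * x.1.adjugate) := by rw [Matrix.mul_adjugate, h.2]; simp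
    _ = x.1.adjugate := by rw [← mul_assoc, h1, one_mul]

lemma apply_one_one (x : SU2) : x.1 1 1 = conj (x.1 0 0) := by
  have := congrFun (congrFun (star_eq_adjugate x) 0) 0
  simpa [Matrix.adjugate_fin_two, Matrix.star_apply] using this.symm

lemma apply_zero_one (x : SU2) : x.1 0 1 = -conj (x.1 1 0) := by
  have := congrFun (congrFun (star_eq_adjugate x) 0) 1
  simp only [Matrix.adjugate_fin_two, Matrix.star_apply] at this
  simp at this
  rw [this, neg_neg]

lemma normSq_add_normSq (x : SU2) :
    Complex.normSq (x.1 0 0) + Complex.normSq (x.1 1 0) = 1 := by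
  have h := (Matrix.mem_specialUnitaryGroup_iff.1 x.2).2
  rw [Matrix.det_fin_two, apply_one_one, apply_zero_one, Complex.mul_conj, neg_mul,
    mul_comm, Complex.mul_conj, sub_neg_eq_add] at h
  exact_mod_cast h

/-- The inner product of the first columns of two matrices in `SU(2)`. -/
noncomputable def overlap (x y : SU2) : ℂ :=
  conj (x.1 0 0) * y.1 0 0 + conj (x.1 1 0) * y.1 1 0

/-- The determinant of the first columns of two matrices in `SU(2)`. -/
noncomputable def columnDet (x y : SU2) : ℂ := x.1 0 0 * y.1 1 0 - x.1 1 0 * y.1 0 0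

/-- Lagrange's identity for two unit vectors of `ℂ²`. -/
lemma normSq_overlap (x y : SU2) :
    Complex.normSq (overlap x y) = 1 - Complex.normSq (columnDet x y) := by
  have hx := normSq_add_normSq x
  have hy := normSq_add_normSq y
  simp only [overlap, columnDet, Complex.normSq_apply, Complex.add_re, Complex.add_im,
    Complex.sub_re, Complex.sub_im, Complex.mul_re, Complex.mul_im, Complex.conj_re,
    Complex.conj_im] at *
  linear_combination hx * ((y.1 0 0).re * (y.1 0 0).re + (y.1 0 0).im * (y.1 0 0).im +
    ((y.1 1 0).re * (y.1 1 0).re + (y.1 1 0).im * (y.1 1 0).im)) + hy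

lemma inner_vecPow (N : ℕ) (a b : Fin 2 → ℂ) :
    ⟪vecPow N a, vecPow N b⟫_ℂ = (∑ i, conj (a i) * b i) ^ N := by
  simp only [vecPow, PiLp.inner_apply, RCLike.inner_apply]
  rw [← Fin.prod_const, Finset.prod_univ_sum]
  simp only [Fintype.piFinset_univ, map_prod, ← Finset.prod_mul_distrib]
  exact Finset.sum_congr rfl fun i _ => Finset.prod_congr rfl fun k _ => mul_comm _ _

lemma norm_inner_U_v (n : ℤ) (x y : SU2) :
    ‖⟪U n x (v n), U n y (v n)⟫_ℂ‖ = ‖overlap x y‖ ^ n.natAbs := by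
  have hU (x : SU2) : (U n x (v n)).1 = vecPow n.natAbs (x.1.mulVec (weightVec n)) := by
    ext i
    rw [U_apply_v_apply]
    rfl
  have h : ⟪U n x (v n), U n y (v n)⟫_ℂ = ⟪(U n x (v n)).1, (U n y (v n)).1⟫_ℂ := rfl
  rw [h, hU, hU, inner_vecPow, norm_pow]
  congr 1
  by_cases hn : 0 ≤ n
  · simp [weightVec, hn, Matrix.mulVec, dotProduct, overlap]
  -- For `n < 0` the second columns enter; their inner product is the conjugate of that of the first
  -- columns.
  · rw [← Complex.norm_conj]
    simp [weightVec, hn, Matrix.mulVec, dotProduct, overlap, apply_one_one, apply_zero_one]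
    congr 1
    ring

lemma norm_U_v (n : ℤ) (x : SU2) : ‖U n x (v n)‖ = 1 := by
  have h := norm_inner_U_v n x x
  have h1 : overlap x x = 1 := by
    have := normSq_add_normSq x
    rw [overlap, mul_comm, Complex.mul_conj, mul_comm, Complex.mul_conj]
    exact_mod_cast this
  rw [h1, norm_one, one_pow, inner_self_eq_norm_sq_to_K, norm_pow] at h
  simpa using (pow_eq_one_iff_of_nonneg (norm_nonneg _) two_ne_zero).1 h

lemma monopoleProj_proj (n : ℤ) (x : SU2) : monopoleProj n (proj x) =
    InnerProductSpace.rankOne ℂ (U n x (v n)) (U n x (v n)) :=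
  projFun_eq n x

lemma proj_surjective : Function.Surjective proj := Quotient.mk_surjective

lemma norm_sq_monopoleProj_sub (n : ℤ) (x y : SU2) :
    ‖monopoleProj n (proj x) - monopoleProj n (proj y)‖ ^ 2 =
      1 - (1 - ‖columnDet x y‖ ^ 2) ^ n.natAbs := by
  rw [monopoleProj_proj, monopoleProj_proj,
    InnerProductSpace.norm_sq_rankOne_sub_rankOne (norm_U_v n x) (norm_U_v n y), norm_inner_U_v,
    pow_right_comm, ← Complex.normSq_eq_norm_sq, normSq_overlap, Complex.normSq_eq_norm_sq]

lemma norm_monopoleProj_sub_le (n : ℤ) (x y : SU2) :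
    ‖monopoleProj n (proj x) - monopoleProj n (proj y)‖ ≤
      √|(n : ℝ)| * ‖columnDet x y‖ := by
  have hN : |(n : ℝ)| = n.natAbs := by rw [Nat.cast_natAbs]; simp
  refine abs_le_of_sq_le_sq' ?_ (by positivity) |>.2
  rw [norm_sq_monopoleProj_sub, mul_pow, Real.sq_sqrt (abs_nonneg _), hN]
  have h := normSq_overlap x y
  rw [Complex.normSq_eq_norm_sq, Complex.normSq_eq_norm_sq] at h
  -- Bernoulli's inequality needs `-2 ≤ -δ²`, which follows from `δ² = 1 - |overlap|² ≤ 1`.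
  have := one_add_mul_le_pow (a := -‖columnDet x y‖ ^ 2)
    (by nlinarith [sq_nonneg ‖overlap x y‖]) n.natAbs
  rw [sub_eq_add_neg 1 (‖columnDet x y‖ ^ 2)]
  linarith

/-! ### The module isomorphism -/

lemma continuous_U_v (n : ℤ) : Continuous fun x : SU2 => U n x (v n) := by
  refine Continuous.subtype_mk (f := fun x : SU2 => (U n x (v n)).1) ?_ _
  refine (PiLp.continuous_toLp 2 _).comp
    (f := fun x : SU2 => fun i => (U n x (v n)).1 i) (continuous_pi fun i => ?_)
  simp only [U_apply_v_apply]
  exact continuous_finsetProd _ fun k _ => (continuous_apply (i k)).comp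
    (Continuous.matrix_mulVec continuous_subtype_val continuous_const)

lemma norm_apply_zero_zero {s : SU2} (hs : s ∈ U1) : ‖s.1 0 0‖ = 1 := by
  have h := normSq_add_normSq s
  rw [hs.2, map_zero, add_zero, Complex.normSq_eq_norm_sq] at h
  exact (pow_eq_one_iff_of_nonneg (norm_nonneg _) two_ne_zero).1 h

lemma U_mul_v (n : ℤ) (x : SU2) {s : SU2} (hs : s ∈ U1) :
    U n (x * s) (v n) = (s.1 0 0 ^ n) • U n x (v n) := by
  have hs0 : s.1 0 0 ≠ 0 := by
    intro h
    have := norm_apply_zero_zero hs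
    simp [h] at this
  have hsv : U n s (v n) = (s.1 0 0 ^ n) • v n := by
    refine Subtype.ext (PiLp.ext fun i => ?_)
    rw [U_apply_v_apply]
    change _ = (s.1 0 0 ^ n) * ∏ k, weightVec n (i k)
    obtain ⟨z, hz, hw⟩ : ∃ z : ℂ, z ^ n.natAbs = s.1 0 0 ^ n ∧
        s.1.mulVec (weightVec n) = z • weightVec n := by
      by_cases hn : 0 ≤ n
      · refine ⟨s.1 0 0, ?_, ?_⟩
        · rw [← zpow_natCast, Int.natAbs_of_nonneg hn]
        · ext i
          fin_cases i <;> simp [weightVec, hn, Matrix.mulVec, dotProduct, hs.2]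
      · refine ⟨s.1 1 1, ?_, ?_⟩
        -- Here the weight is `conj z = z⁻¹`, so its `|n|`-th power is `z ^ n`.
        · rw [← zpow_natCast, Int.ofNat_natAbs_of_nonpos (by omega), apply_one_one,
            ← Complex.inv_eq_conj (norm_apply_zero_zero hs), inv_zpow', neg_neg]
        · ext i
          fin_cases i <;> simp [weightVec, hn, Matrix.mulVec, dotProduct, hs.1]
    rw [hw, ← hz]
    simp [Finset.prod_mul_distrib]
  rw [map_mul, mul_apply_eq_comp, hsv, map_smul]

lemma conj_mul_zpow (n : ℤ) {s : SU2} (hs : s ∈ U1) :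
    conj (s.1 0 0 ^ n) * s.1 0 0 ^ n = 1 := by
  rw [mul_comm, Complex.mul_conj, Complex.normSq_eq_norm_sq, norm_zpow, norm_apply_zero_zero hs]
  simp

/-- The section of `p_n C(S², K_n)` of an equivariant function. -/
noncomputable def toSection (n : ℤ) (ξ : Xi n) : C(Sphere, K n) where
  toFun := Quotient.lift (fun x => ξ.1 x • U n x (v n)) fun x y h => by
    have hs : x⁻¹ * y ∈ U1 := QuotientGroup.leftRel_apply.1 h
    have h1 := ξ.2 x _ hs
    have h2 := U_mul_v n x hs
    rw [mul_inv_cancel_left] at h1 h2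
    change _ = ξ.1 y • U n y (v n)
    rw [h1, h2, smul_smul, mul_right_comm, conj_mul_zpow n hs, one_mul]
  continuous_toFun := (ξ.1.continuous.smul (continuous_U_v n)).quotient_lift _

lemma toSection_proj (n : ℤ) (ξ : Xi n) (x : SU2) :
    toSection n ξ (proj x) = ξ.1 x • U n x (v n) := rfl

/-- The equivariant function of a section of `p_n C(S², K_n)`. -/
noncomputable def ofSection (n : ℤ) (F : C(Sphere, K n)) : Xi n :=
  ⟨⟨fun x => ⟪U n x (v n), F (proj x)⟫_ℂ,
    (continuous_U_v n).inner (F.continuous.comp proj.continuous)⟩, by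
    intro x s hs
    simp only [ContinuousMap.coe_mk]
    rw [proj_mul x s hs, U_mul_v n x hs, inner_smul_left]⟩

lemma ofSection_apply (n : ℤ) (F : C(Sphere, K n)) (x : SU2) :
    (ofSection n F).1 x = ⟪U n x (v n), F (proj x)⟫_ℂ := rfl

lemma inner_U_v_self (n : ℤ) (x : SU2) : ⟪U n x (v n), U n x (v n)⟫_ℂ = 1 := by
  simp [inner_self_eq_norm_sq_to_K, norm_U_v]

/-- `Ξ_n ≅ p_n C(S², K_n)`. -/
noncomputable def xiEquiv (n : ℤ) : Xi n ≃ₗ[C(Sphere, ℂ)] projRange (monopoleProj n) where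
  toFun ξ := ⟨toSection n ξ, fun a => by
    obtain ⟨x, rfl⟩ := proj_surjective a
    rw [toSection_proj, monopoleProj_proj, InnerProductSpace.rankOne_apply, inner_smul_right,
      inner_U_v_self, mul_one]⟩
  map_add' ξ η := Subtype.ext <| ContinuousMap.ext fun a => by
    obtain ⟨x, rfl⟩ := proj_surjective a
    exact add_smul (ξ.1 x) (η.1 x) (U n x (v n))
  map_smul' f ξ := Subtype.ext <| ContinuousMap.ext fun a => by
    obtain ⟨x, rfl⟩ := proj_surjective a
    exact mul_smul (f (proj x)) (ξ.1 x) (U n x (v n))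
  invFun F := ofSection n F.1
  left_inv ξ := Subtype.ext <| ContinuousMap.ext fun x => by
    rw [ofSection_apply]
    simp only [toSection_proj]
    rw [inner_smul_right, inner_U_v_self, mul_one]
  right_inv F := Subtype.ext <| ContinuousMap.ext fun a => by
    obtain ⟨x, rfl⟩ := proj_surjective a
    rw [toSection_proj, ofSection_apply]
    -- Being fixed by the rank one projection says exactly that `F = ⟪U_x v, F⟫ U_x v`.
    have := F.2 (proj x)
    rwa [monopoleProj_proj, InnerProductSpace.rankOne_apply] at this

/-! ### The lower bound for the distance -/

open Set MeasureTheory Filter Topology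

/-- The Hopf map, as a map into `ℂ²`. -/
noncomputable def hopf (x : SU2) : EuclideanSpace ℂ (Fin 2) :=
  !₂[x.1 1 0 * conj (x.1 1 0), conj (x.1 0 0) * x.1 1 0]

/-- The coordinates of `hopf` are entries of the projection onto the first column. The image lies on
the sphere of radius 1/2 centred at `(1/2, 0)`, and `‖columnDet‖` is the chordal distance there. -/
lemma norm_hopf_sub (x y : SU2) : ‖hopf x - hopf y‖ = ‖columnDet y x‖ := by
  rw [← sq_eq_sq₀ (norm_nonneg _) (norm_nonneg _), EuclideanSpace.norm_sq_eq]
  have hx := normSq_add_normSq x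
  have hy := normSq_add_normSq y
  simp only [hopf, columnDet, Fin.sum_univ_two, ← Complex.normSq_eq_norm_sq, PiLp.sub_apply,
    Matrix.cons_val_zero, Matrix.cons_val_one, Complex.normSq_apply,
    Complex.sub_re, Complex.sub_im, Complex.mul_re, Complex.mul_im, Complex.conj_re,
    Complex.conj_im] at *
  linear_combination ((x.1 1 0).re * (x.1 1 0).re + (x.1 1 0).im * (x.1 1 0).im -
    ((y.1 1 0).re * (y.1 1 0).re + (y.1 1 0).im * (y.1 1 0).im)) * (hx - hy)

lemma hasDerivWithinAt_velocity {γ : ℝ → SU2} (hγ : IsC1Curve γ) {t : ℝ} (ht : t ∈ Icc (0 : ℝ) 1)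
    (i j : Fin 2) :
    HasDerivWithinAt (fun s => (γ s).1 i j) (velocity γ t i j) (Icc 0 1) t :=
  ((hγ i j).differentiableOn one_ne_zero t ht).hasDerivWithinAt

lemma uniqueDiffWithinAt_Icc_zero_one {t : ℝ} (ht : t ∈ Icc (0 : ℝ) 1) :
    UniqueDiffWithinAt ℝ (Icc (0 : ℝ) 1) t :=
  uniqueDiffOn_Icc zero_lt_one t ht

lemma hasDerivWithinAt_conj {f : ℝ → ℂ} {f' : ℂ} {s : Set ℝ} {t : ℝ}
    (h : HasDerivWithinAt f f' s t) : HasDerivWithinAt (fun u => conj (f u)) (conj f') s t :=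
  Complex.conjCLE.toContinuousLinearMap.hasFDerivAt.comp_hasDerivWithinAt t h

/-- The lower left entry of `γ* γ'` is the determinant of the first columns of `γ` and `γ'`. The
upper right entry is minus its conjugate, so the factor 1/2 in the inner product leaves one squared
modulus. -/
lemma lieNorm_horizontal {γ : ℝ → SU2} (hγ : IsC1Curve γ) {t : ℝ} (ht : t ∈ Icc (0 : ℝ) 1) :
    lieNorm (horizontal (star (γ t).1 * velocity γ t)) =
      ‖(γ t).1 0 0 * velocity γ t 1 0 - (γ t).1 1 0 * velocity γ t 0 0‖ := by
  have h11 : velocity γ t 1 1 = conj (velocity γ t 0 0) := by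
    refine (uniqueDiffWithinAt_Icc_zero_one ht).eq_deriv _ (hasDerivWithinAt_velocity hγ ht 1 1) ?_
    simpa only [apply_one_one] using hasDerivWithinAt_conj (hasDerivWithinAt_velocity hγ ht 0 0)
  have h01 : velocity γ t 0 1 = -conj (velocity γ t 1 0) := by
    refine (uniqueDiffWithinAt_Icc_zero_one ht).eq_deriv _ (hasDerivWithinAt_velocity hγ ht 0 1) ?_
    simpa only [apply_zero_one] using
      (hasDerivWithinAt_conj (hasDerivWithinAt_velocity hγ ht 1 0)).fun_neg
  have h : 2⁻¹ * (Matrix.trace (horizontal (star (γ t).1 * velocity γ t) *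
      star (horizontal (star (γ t).1 * velocity γ t)))).re =
        ‖(γ t).1 0 0 * velocity γ t 1 0 - (γ t).1 1 0 * velocity γ t 0 0‖ ^ 2 := by
    rw [← Complex.normSq_eq_norm_sq]
    simp [horizontal, Matrix.trace_fin_two, Matrix.mul_apply, Fin.sum_univ_two,
      Matrix.star_apply, h11, h01, apply_one_one, apply_zero_one, Complex.normSq_apply]
    ring
  rw [lieNorm, h, Real.sqrt_sq (norm_nonneg _)]

/-- With `lieNorm_horizontal`, this says that the Hopf map is isometric from the quotient metric to
`ℂ²`. -/
lemma norm_derivWithin_hopf {γ : ℝ → SU2} (hγ : IsC1Curve γ)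
    (hh : ContDiffOn ℝ 1 (fun s => hopf (γ s)) (Icc 0 1)) {t : ℝ} (ht : t ∈ Icc (0 : ℝ) 1) :
    ‖derivWithin (fun s => hopf (γ s)) (Icc 0 1) t‖ =
      ‖(γ t).1 0 0 * velocity γ t 1 0 - (γ t).1 1 0 * velocity γ t 0 0‖ := by
  have hd := (hh.differentiableOn one_ne_zero t ht).hasDerivWithinAt
  set D := derivWithin (fun s => hopf (γ s)) (Icc 0 1) t
  have hu := uniqueDiffWithinAt_Icc_zero_one ht
  have hD (i : Fin 2) : HasDerivWithinAt (fun s => hopf (γ s) i) (D i) (Icc 0 1) t :=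
    (PiLp.proj 2 (𝕜 := ℝ) (fun _ : Fin 2 => ℂ) i).hasFDerivAt.comp_hasDerivWithinAt t hd
  have hp := hasDerivWithinAt_velocity hγ ht 0 0
  have hq := hasDerivWithinAt_velocity hγ ht 1 0
  have h0 := hu.eq_deriv _ (hD 0) (hq.fun_mul (hasDerivWithinAt_conj hq))
  have h1 := hu.eq_deriv _ (hD 1) ((hasDerivWithinAt_conj hp).fun_mul hq)
  -- Differentiating the constraint `|γ₀₀|² + |γ₁₀|² = 1` supplies the relation that the two squared
  -- norms need in order to agree.
  have hs := hu.eq_deriv _ (hasDerivWithinAt_const t (Icc (0 : ℝ) 1) (1 : ℂ))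
    (((hp.fun_mul (hasDerivWithinAt_conj hp)).fun_add
      (hq.fun_mul (hasDerivWithinAt_conj hq))).congr_of_mem (fun s _ => by
        rw [Complex.mul_conj, Complex.mul_conj]
        exact_mod_cast (normSq_add_normSq (γ s)).symm) ht)
  have hre := congrArg Complex.re hs
  rw [← sq_eq_sq₀ (norm_nonneg _) (norm_nonneg _), EuclideanSpace.norm_sq_eq]
  simp only [Fin.sum_univ_two, h0, h1, ← Complex.normSq_eq_norm_sq, Complex.normSq_apply,
    Complex.sub_re, Complex.sub_im, Complex.mul_re, Complex.mul_im, Complex.conj_re,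
    Complex.conj_im, Complex.add_re, Complex.add_im, Complex.zero_re] at *
  linear_combination -2 * (((γ t).1 1 0).re * (velocity γ t 1 0).re +
    ((γ t).1 1 0).im * (velocity γ t 1 0).im) * hre

lemma contDiffOn_hopf {γ : ℝ → SU2} (hγ : IsC1Curve γ) :
    ContDiffOn ℝ 1 (fun s => hopf (γ s)) (Icc 0 1) := by
  have hc (i j : Fin 2) : ContDiffOn ℝ 1 (fun s => conj ((γ s).1 i j)) (Icc 0 1) :=
    Complex.conjCLE.contDiff.comp_contDiffOn (hγ i j)
  refine (PiLp.contDiff_toLp (𝕜 := ℝ) (p := 2) (E := fun _ : Fin 2 => ℂ)).comp_contDiffOn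
    (contDiffOn_pi.2 fun i => ?_)
  fin_cases i
  · exact (hγ 1 0).mul (hc 1 0)
  · exact (hc 0 0).mul (hγ 1 0)

/-- A chord is no longer than the curve joining its ends, applied to the Hopf image of `γ`. -/
lemma enorm_columnDet_le_quotientLength {γ : ℝ → SU2} (hγ : IsC1Curve γ) :
    ‖columnDet (γ 0) (γ 1)‖ₑ ≤ quotientLength γ := by
  have hh := contDiffOn_hopf hγ
  have h := enorm_sub_le_lintegral_derivWithin_Icc_of_contDiffOn_Icc hh zero_le_one
  rw [← ofReal_norm, norm_hopf_sub, ofReal_norm] at h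
  refine h.trans_eq (setLIntegral_congr_fun measurableSet_Icc fun t ht => ?_)
  simp only [lieNorm_horizontal hγ ht]
  rw [← norm_derivWithin_hopf hγ hh ht, ofReal_norm]

lemma enorm_monopoleProj_sub_le (n : ℤ) (a b : Sphere) :
    ‖monopoleProj n a - monopoleProj n b‖ₑ ≤
      ENNReal.ofReal √|(n : ℝ)| * sphereDist a b := by
  have hle (x y : SU2) : ‖monopoleProj n (proj x) - monopoleProj n (proj y)‖ₑ ≤
      ENNReal.ofReal √|(n : ℝ)| * ‖columnDet x y‖ₑ := by
    rw [← ofReal_norm, ← ofReal_norm (columnDet x y), ← ENNReal.ofReal_mul (Real.sqrt_nonneg _)]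
    exact ENNReal.ofReal_le_ofReal (norm_monopoleProj_sub_le n x y)
  -- The constant is moved inside the infimum only when it is nonzero; if it is zero, `hle` already
  -- makes the left side vanish.
  rcases eq_or_ne (ENNReal.ofReal √|(n : ℝ)|) 0 with hn | hn
  · obtain ⟨x, rfl⟩ := proj_surjective a
    obtain ⟨y, rfl⟩ := proj_surjective b
    simpa only [hn, zero_mul] using hle x y
  · simp only [sphereDist, ENNReal.mul_iInf_of_ne hn ENNReal.ofReal_ne_top]
    refine le_iInf₂ ?_
    rintro γ ⟨hγ, rfl, rfl⟩
    exact (hle _ _).trans (mul_le_mul_right (enorm_columnDet_le_quotientLength hγ) _)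

/-! ### The upper bound for the distance -/

/-- The rotation by the angle `θ`. -/
noncomputable def rotation (θ : ℝ) : SU2 :=
  ⟨!![(Real.cos θ : ℂ), -(Real.sin θ : ℂ); (Real.sin θ : ℂ), (Real.cos θ : ℂ)], by
    have h : (Real.cos θ : ℂ) * Real.cos θ + Real.sin θ * Real.sin θ = 1 := by
      rw [← sq, ← sq, add_comm]
      exact_mod_cast Real.sin_sq_add_cos_sq θ
    rw [Matrix.mem_specialUnitaryGroup_iff, Matrix.mem_unitaryGroup_iff]
    constructor
    · ext i j
      fin_cases i <;> fin_cases j <;>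
        simp [Matrix.mul_apply, Fin.sum_univ_two, Matrix.star_apply, -Complex.ofReal_cos, -Complex.ofReal_sin, Complex.conj_ofReal] <;>
        first | linear_combination h | ring
    · rw [Matrix.det_fin_two_of]
      linear_combination h⟩

lemma isC1Curve_rotation (θ : ℝ) : IsC1Curve fun t => rotation (t * θ) := by
  have hc : ContDiff ℝ 1 fun t : ℝ => ((Real.cos (t * θ) : ℝ) : ℂ) :=
    Complex.ofRealCLM.contDiff.comp
      (Real.contDiff_cos.comp (contDiff_id.mul contDiff_const))
  have hs : ContDiff ℝ 1 fun t : ℝ => ((Real.sin (t * θ) : ℝ) : ℂ) :=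
    Complex.ofRealCLM.contDiff.comp
      (Real.contDiff_sin.comp (contDiff_id.mul contDiff_const))
  intro i j
  fin_cases i <;> fin_cases j
  · exact hc.contDiffOn
  · exact hs.neg.contDiffOn
  · exact hs.contDiffOn
  · exact hc.contDiffOn

/-- The rotations form a one-parameter group whose generator is off-diagonal of norm 1, so the speed
is constantly `θ`. -/
lemma quotientLength_rotation {θ : ℝ} (hθ : 0 ≤ θ) :
    quotientLength (fun t => rotation (t * θ)) = ENNReal.ofReal θ := by
  have h : ∀ t ∈ Icc (0 : ℝ) 1, lieNorm (horizontal
      (star (rotation (t * θ)).1 * velocity (fun t => rotation (t * θ)) t)) = θ := by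
    intro t ht
    rw [lieNorm_horizontal (isC1Curve_rotation θ) ht]
    have hu := uniqueDiffWithinAt_Icc_zero_one ht
    have hm : HasDerivAt (fun t : ℝ => t * θ) θ t := by simpa using (hasDerivAt_id t).mul_const θ
    have h0 := hu.eq_deriv _ (hasDerivWithinAt_velocity (isC1Curve_rotation θ) ht 0 0)
      (((Real.hasDerivAt_cos _).comp t hm).ofReal_comp.hasDerivWithinAt)
    have h1 := hu.eq_deriv _ (hasDerivWithinAt_velocity (isC1Curve_rotation θ) ht 1 0)
      (((Real.hasDerivAt_sin _).comp t hm).ofReal_comp.hasDerivWithinAt)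
    rw [h0, h1]
    change ‖((Real.cos (t * θ) : ℝ) : ℂ) * ((Real.cos (t * θ) * θ : ℝ) : ℂ) -
      ((Real.sin (t * θ) : ℝ) : ℂ) * ((-Real.sin (t * θ) * θ : ℝ) : ℂ)‖ = θ
    rw [← Complex.ofReal_mul, ← Complex.ofReal_mul, ← Complex.ofReal_sub, Complex.norm_real]
    have : Real.cos (t * θ) * (Real.cos (t * θ) * θ) -
        Real.sin (t * θ) * (-Real.sin (t * θ) * θ) = θ := by
      linear_combination θ * Real.sin_sq_add_cos_sq (t * θ)
    rw [this, Real.norm_of_nonneg hθ]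
  rw [quotientLength, setLIntegral_congr_fun measurableSet_Icc
    (g := fun _ => ENNReal.ofReal θ) fun t ht => by simp only [h t ht]]
  simp

lemma sphereDist_rotation_le {θ : ℝ} (hθ : 0 ≤ θ) :
    sphereDist (proj (rotation 0)) (proj (rotation θ)) ≤ ENNReal.ofReal θ := by
  rw [← quotientLength_rotation hθ]
  exact iInf₂_le (fun t => rotation (t * θ)) ⟨isC1Curve_rotation θ, by simp, by simp⟩

/-- The geometric sum factors `1 - cos² ^ |n|` as `sin²` times a sum; pulling out the sine lets
division by `θ` produce `sinc`, which is continuous at 0. -/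
lemma norm_monopoleProj_rotation_sub (n : ℤ) (θ : ℝ) :
    ‖monopoleProj n (proj (rotation 0)) - monopoleProj n (proj (rotation θ))‖ =
      |Real.sin θ| * √(∑ k ∈ Finset.range n.natAbs, (Real.cos θ ^ 2) ^ k) := by
  have hdet : columnDet (rotation 0) (rotation θ) = (Real.sin θ : ℂ) := by
    simp [columnDet, rotation]
  rw [← sq_eq_sq₀ (norm_nonneg _) (by positivity), norm_sq_monopoleProj_sub, hdet,
    Complex.norm_real, Real.norm_eq_abs, sq_abs, mul_pow, sq_abs,
    Real.sq_sqrt (Finset.sum_nonneg fun _ _ => by positivity), ← Real.cos_sq', Real.sin_sq,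
    mul_neg_geom_sum]

lemma ofReal_sinc_mul_le_lipConst (n : ℤ) {θ : ℝ} (h0 : 0 < θ) (hπ : θ < Real.pi) :
    ENNReal.ofReal (Real.sinc θ * √(∑ k ∈ Finset.range n.natAbs, (Real.cos θ ^ 2) ^ k)) ≤
      lipConst (monopoleProj n) := by
  have hsin := Real.sin_pos_of_pos_of_lt_pi h0 hπ
  rcases eq_or_ne n 0 with rfl | hn
  · simp
  -- The supremum runs over distinct points. Equal classes would make the norm zero, but `sin θ > 0`
  -- and the sum contains the term `1` at `k = 0`.
  have hne : proj (rotation 0) ≠ proj (rotation θ) := by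
    intro h
    have hd := norm_monopoleProj_rotation_sub n θ
    have hpos : 0 < ∑ k ∈ Finset.range n.natAbs, (Real.cos θ ^ 2) ^ k := by
      obtain ⟨m, hm⟩ := Nat.exists_eq_succ_of_ne_zero (Int.natAbs_ne_zero.2 hn)
      rw [hm, Finset.sum_range_succ']
      have : 0 ≤ ∑ k ∈ Finset.range m, (Real.cos θ ^ 2) ^ (k + 1) :=
        Finset.sum_nonneg fun _ _ => by positivity
      simp only [pow_zero]
      linarith
    rw [h, sub_self, norm_zero, abs_of_pos hsin] at hd
    have := mul_pos hsin (Real.sqrt_pos.2 hpos)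
    linarith
  refine le_trans ?_ (le_iSup_of_le (proj (rotation 0)) (le_iSup_of_le (proj (rotation θ))
    (le_iSup_of_le hne le_rfl)))
  refine le_trans ?_ (ENNReal.div_le_div_left (sphereDist_rotation_le h0.le) _)
  rw [← ofReal_norm, norm_monopoleProj_rotation_sub, ← ENNReal.ofReal_div_of_pos h0,
    Real.sinc_of_ne_zero h0.ne', abs_of_pos hsin, div_mul_eq_mul_div]

lemma le_lipConst (n : ℤ) : ENNReal.ofReal √|(n : ℝ)| ≤ lipConst (monopoleProj n) := by
  have hc : Continuous fun θ : ℝ => ENNReal.ofReal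
      (Real.sinc θ * √(∑ k ∈ Finset.range n.natAbs, (Real.cos θ ^ 2) ^ k)) := by
    refine ENNReal.continuous_ofReal.comp (Real.continuous_sinc.mul (Real.continuous_sqrt.comp ?_))
    fun_prop
  have ht := (hc.tendsto 0).mono_left (nhdsWithin_le_nhds (s := Ioi 0))
  -- At `θ = 0` each of the `|n|` summands equals 1.
  have h0 : Real.sinc 0 * √(∑ k ∈ Finset.range n.natAbs, (Real.cos 0 ^ 2) ^ k) = √|(n : ℝ)| := by
    simp
  rw [h0] at ht
  refine le_of_tendsto ht ?_
  filter_upwards [Ioo_mem_nhdsGT Real.pi_pos] with θ hθ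
  exact ofReal_sinc_mul_le_lipConst n hθ.1 hθ.2

end Monopole

theorem theorem16p2 (n : ℤ) :
    (∀ a, IsStarProjection (Monopole.monopoleProj n a)) ∧
    Nonempty (Monopole.Xi n ≃ₗ[C(Monopole.Sphere, ℂ)]
      Monopole.projRange (Monopole.monopoleProj n)) ∧
    Monopole.lipConst (Monopole.monopoleProj n) = ENNReal.ofReal (Real.sqrt |(n : ℝ)|) := by
  refine ⟨fun a => ?_, ⟨Monopole.xiEquiv n⟩, le_antisymm ?_ (Monopole.le_lipConst n)⟩
  · obtain ⟨x, rfl⟩ := Monopole.proj_surjective a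
    rw [Monopole.monopoleProj_proj]
    exact InnerProductSpace.isStarProjection_rankOne_self (Monopole.norm_U_v n x)
  · exact iSup_le fun a => iSup_le fun b => iSup_le fun _ =>
      ENNReal.div_le_of_le_mul (Monopole.enorm_monopoleProj_sub_le n a b)
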